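/- All semigroups are finite. A relational morphism $\rho\colon S\to T$ of semigroups assigns to every $s\in S$ a nonempty subset $s\rho\subseteq T$ such that $(s\rho)(s'\rho)\subseteq (ss')\rho$ for all $s,s'\in S$. Adjoin new identities to form $S^I=S\cup\{I\}$ and $T^I=T\cup\{I\}$ and extend $\rho$ by $I\rho=\{I\}$. The derived category of $\rho$ has as objects the elements of $T^I$; an arrow from $a$ to $b$ is the class of a triple $(a,(x,y))$ with $x\in S^I$, $y\in x\rho$ and $ay=b$, where $(a,(x,y))$ and $(a,(x',y'))$ with $ay=ay'$ are identified if $zx=zx'$ for all $z\in S^I$ with $a\in z\rho$; the composite of $(a,(x,y))$ and $(ay,(x',y'))$ is $(a,(xx',yy'))$. The derived semigroup $D(\rho)$ is the consolidation of this category, that is, the set of all its arrows together with a new zero element, where the product of two composable arrows is their composite and all other products are $0$. For pseudovarieties $\mathbf V,\mathbf W$ of finite semigroups (classes closed under finite direct products, subsemigroups and homomorphic images) let $\mathbf V*\mathbf W$ be the pseudovariety generated by all semidirect products $S\rtimes T$ with $S\in\mathbf V$, $T\in\mathbf W$, formed with respect to a left action of $T$ on $S$ by endomorphisms. Let $\mathbf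 A$ be the pseudovariety of aperiodic finite semigroups (those all of whose subgroups are trivial), $\mathbf G$ the pseudovariety of finite groups, $\mathbf C_0=\mathbf A$ and $\mathbf C_{n+1}=\mathbf A*\mathbf G*\mathbf C_n$. The complexity of $S$ is $Sc=\min\{n\geq 0\mid S\in\mathbf C_n\}$. Theorem. Let $n\geq 1$. A semigroup $S$ satisfies $Sc\leq n$ if and only if there are a semigroup $T$ with $Tc\leq n-1$ and a relational morphism $\rho\colon S\to T$ such that $D(\rho)c\leq 1$. -/

import Mathlib

universe u v w

namespace KrohnRhodes

open CategoryTheory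

/-! Aperiodic semigroups and groups, as classes of finite semigroups -/

/-- A finite semigroup is aperiodic if all its subgroups (the images of embeddings of groups)
are trivial. -/
def IsAperiodic (S : Type u) [Semigroup S] : Prop :=
  Finite S ∧ ∀ (G : Type u) [Group G] (f : G →ₙ* S), Function.Injective f → Subsingleton G

/-- The semigroup `S` is a finite group. -/
def IsFiniteGroup (S : Type u) [Semigroup S] : Prop :=
  Finite S ∧ ∃ (G : Type u) (_ : Group G), Nonempty (S ≃* G)

/-! Semidirect products of semigroups -/

/-- A left action of the semigroup `T` on the semigroup `S` by endomorphisms. If `T` has an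
identity element, it is not required to act as the identity. -/
structure LeftAction (T : Type u) (S : Type v) [Semigroup T] [Semigroup S] where
  act : T → S → S
  mul_act : ∀ t t' s, act (t * t') s = act t (act t' s)
  act_mul : ∀ t s s', act t (s * s') = act t s * act t s'

/-- The underlying set `S × T` of the semidirect product `S ⋊ T`. -/
@[ext]
structure Semidirect {T : Type u} {S : Type v} [Semigroup T] [Semigroup S]
    (β : LeftAction T S) where
  left : S
  right : T

/-- The multiplication `(s, t) (s', t') = (s (t s'), t t')`. -/
instance {T : Type u} {S : Type v} [Semigroup T] [Semigroup S] (β : LeftAction T S) :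
    Semigroup (Semidirect β) where
  mul x y := ⟨x.left * β.act x.right y.left, x.right * y.right⟩
  mul_assoc x y z := by
    apply Semidirect.ext
    · change (x.left * β.act x.right y.left) * β.act (x.right * y.right) z.left =
        x.left * β.act x.right (y.left * β.act y.right z.left)
      rw [β.mul_act, β.act_mul, mul_assoc]
    · exact mul_assoc _ _ _

/-! Pseudovarieties and complexity -/

/-- A class of semigroups. -/
abbrev SemigroupClass : Type (u + 1) := ∀ (S : Type u) [Semigroup S], Prop

/-- A pseudovariety is a class of finite semigroups that is closed under finite direct products
(including the empty one), subsemigroups and homomorphic images. -/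
structure IsPseudovariety (P : SemigroupClass.{u}) : Prop where
  finite : ∀ (S : Type u) [Semigroup S], P S → Finite S
  unit : P PUnit.{u + 1}
  prod : ∀ (S T : Type u) [Semigroup S] [Semigroup T], P S → P T → P (S × T)
  sub : ∀ (S T : Type u) [Semigroup S] [Semigroup T] (f : S →ₙ* T),
    Function.Injective f → P T → P S
  quotient : ∀ (S T : Type u) [Semigroup S] [Semigroup T] (f : S →ₙ* T),
    Function.Surjective f → P S → P T

/-- The pseudovariety `V ∗ W` generated by all semidirect products `S ⋊ T` with `S` in `V` and
`T` in `W` (for classes `V`, `W` of finite semigroups): the intersection of all pseudovarieties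
that contain these semidirect products. -/
def star (V W : SemigroupClass.{u}) : SemigroupClass.{u} := fun U _ =>
  ∀ P : SemigroupClass.{u}, IsPseudovariety P →
    (∀ (S T : Type u) [Semigroup S] [Semigroup T] (β : LeftAction T S),
      V S → W T → P (Semidirect β)) →
    P U

/-- The complexity pseudovarieties `C₀ = A` and `Cₙ₊₁ = A ∗ (G ∗ Cₙ)`. -/
def complexityClass : ℕ → SemigroupClass.{u}
  | 0 => fun S _ => IsAperiodic S
  | n + 1 => star (fun S _ => IsAperiodic S)
      (star (fun S _ => IsFiniteGroup S) (complexityClass n))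

/-- The Krohn-Rhodes complexity `min {n | S ∈ Cₙ}`. The minimum is formed in `ℕ∞` (so it would
be `⊤` for a semigroup that lies in no `Cₙ`). -/
noncomputable def complexity (S : Type u) [Semigroup S] : ℕ∞ :=
  sInf {m : ℕ∞ | ∃ n : ℕ, m = n ∧ complexityClass n S}

/-! Relational morphisms and their derived semigroups -/

/-- A relational morphism: every `s` is related to at least one `t`, and the relation is a
subsemigroup of `S × T`. -/
structure RelationalMorphism (S : Type u) (T : Type v) [Semigroup S] [Semigroup T] where
  rel : S → Set T
  nonempty : ∀ s, (rel s).Nonempty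
  mul_mem : ∀ {s s' t t'}, t ∈ rel s → t' ∈ rel s' → t * t' ∈ rel (s * s')

section Derived

variable {S : Type u} {T : Type v} [Semigroup S] [Semigroup T]

/-- The extension of a relational morphism from `S` to `T` to the monoids obtained by adjoining
new identities: the new identities are related exactly to each other. -/
def RelationalMorphism.relOne (ρ : RelationalMorphism S T) (x : WithOne S) : Set (WithOne T) :=
  {y | (x = 1 ∧ y = 1) ∨ ∃ (s : S) (t : T), t ∈ ρ.rel s ∧ x = s ∧ y = t}

theorem RelationalMorphism.one_mem_relOne (ρ : RelationalMorphism S T) :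
    (1 : WithOne T) ∈ ρ.relOne 1 := Or.inl ⟨rfl, rfl⟩

theorem RelationalMorphism.mul_mem_relOne (ρ : RelationalMorphism S T) {x x' : WithOne S}
    {y y' : WithOne T} (h : y ∈ ρ.relOne x) (h' : y' ∈ ρ.relOne x') :
    y * y' ∈ ρ.relOne (x * x') := by
  rcases h with ⟨rfl, rfl⟩ | ⟨s, t, h, rfl, rfl⟩
  · simpa using h'
  · rcases h' with ⟨rfl, rfl⟩ | ⟨s', t', h', rfl, rfl⟩
    · exact Or.inr ⟨s, t, h, by simp, by simp⟩
    · exact Or.inr ⟨s * s', t * t', ρ.mul_mem h h', by simp, by simp⟩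

/-- The objects of the derived category are the elements of `T` and a new identity. -/
def DerivedCategory (_ρ : RelationalMorphism S T) : Type v := WithOne T

/-- The representatives `(a, (x, y))` of the arrows from `a` to `b = a y`, where `y` is related
to `x`. -/
structure PreArrow (ρ : RelationalMorphism S T) (a b : WithOne T) where
  fst : WithOne S
  snd : WithOne T
  mem : snd ∈ ρ.relOne fst
  target : a * snd = b

/-- Two representatives `(a, (x, y))` and `(a, (x', y'))` with the same target give the same
arrow if `z x = z x'` for all `z` to which `a` is related. -/
def preArrowSetoid (ρ : RelationalMorphism S T) (a b : WithOne T) :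
    Setoid (PreArrow ρ a b) where
  r p q := ∀ z : WithOne S, a ∈ ρ.relOne z → z * p.fst = z * q.fst
  iseqv :=
    { refl := fun _ _ _ => rfl
      symm := fun h z hz => (h z hz).symm
      trans := fun h h' z hz => (h z hz).trans (h' z hz) }

/-- The composition `(a, (x, y)) (a y, (x', y')) = (a, (x x', y y'))`. -/
def PreArrow.comp {ρ : RelationalMorphism S T} {a b c : WithOne T}
    (p : PreArrow ρ a b) (q : PreArrow ρ b c) : PreArrow ρ a c where
  fst := p.fst * q.fst
  snd := p.snd * q.snd
  mem := ρ.mul_mem_relOne p.mem q.mem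
  target := by rw [← mul_assoc, p.target, q.target]

/-- The derived category of a relational morphism. -/
instance derivedCategory (ρ : RelationalMorphism S T) :
    Category.{max u v} (DerivedCategory ρ) where
  Hom a b := Quotient (preArrowSetoid ρ a b)
  id a := Quotient.mk _ ⟨1, 1, ρ.one_mem_relOne, mul_one (M := WithOne T) a⟩
  comp := Quotient.map₂ PreArrow.comp (by
    intro p p' hp q q' hq z hz
    change z * (p.fst * q.fst) = z * (p'.fst * q'.fst)
    rw [← mul_assoc, ← mul_assoc, hp z hz]
    have hm := ρ.mul_mem_relOne hz p'.mem
    rw [p'.target] at hm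
    exact hq _ hm)
  id_comp f := by
    induction f using Quotient.inductionOn
    exact Quotient.sound fun z _ => congrArg (z * ·) (one_mul _)
  comp_id f := by
    induction f using Quotient.inductionOn
    exact Quotient.sound fun z _ => congrArg (z * ·) (mul_one _)
  assoc f g h := by
    induction f using Quotient.inductionOn
    induction g using Quotient.inductionOn
    induction h using Quotient.inductionOn
    exact Quotient.sound fun z _ => congrArg (z * ·) (mul_assoc _ _ _)

end Derived

/-- The set of all arrows of a category together with a new element `zero`. -/
inductive Consolidation (C : Type v) [Category.{w} C] : Type (max v w)
  | zero : Consolidation C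
  | arrow {X Y : C} (f : X ⟶ Y) : Consolidation C

open Classical in
/-- The product of composable arrows is their composite (in the order of the arrows), every
other product is zero. -/
noncomputable def Consolidation.mul {C : Type v} [Category.{w} C] :
    Consolidation C → Consolidation C → Consolidation C
  | @arrow _ _ _ Y f, @arrow _ _ Y' _ g =>
      if h : Y = Y' then arrow (f ≫ eqToHom h ≫ g) else zero
  | _, _ => zero

noncomputable instance {C : Type v} [Category.{w} C] : Semigroup (Consolidation C) where
  mul := Consolidation.mul
  mul_assoc x y z := by
    change Consolidation.mul (Consolidation.mul x y) z =
      Consolidation.mul x (Consolidation.mul y z)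
    rcases x with _ | @⟨X, Y, f⟩ <;> rcases y with _ | @⟨Y', Z, g⟩ <;>
      rcases z with _ | @⟨Z', W, h⟩ <;> try (simp only [Consolidation.mul]; done)
    · simp only [Consolidation.mul]; split_ifs <;> rfl
    · by_cases h₁ : Y = Y'
      · subst h₁
        by_cases h₂ : Z = Z'
        · subst h₂
          simp [Consolidation.mul]
        · simp [Consolidation.mul, h₂]
      · by_cases h₂ : Z = Z'
        · subst h₂
          simp [Consolidation.mul, h₁]
        · simp [Consolidation.mul, h₁, h₂]

/-- The derived semigroup of a relational morphism: the consolidation of its derived category. -/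
abbrev DerivedSemigroup {S : Type u} {T : Type v} [Semigroup S] [Semigroup T]
    (ρ : RelationalMorphism S T) : Type (max u v) :=
  Consolidation (DerivedCategory ρ)

end KrohnRhodes

/-!
The proof rests on two relations between wreath products and derived semigroups. All inclusions
are phrased with division: `S` divides `T` if a relational morphism from `S` to `T` has pairwise
disjoint values, and then `S` lies in every pseudovariety that contains `T`. Up to division the
members of `V ∗ W` are the semidirect products themselves (`exists_divides_of_mem_star`).

If `ρ` is a relational morphism from `S` to `T` then `S` divides `D(ρ) ≀ T`
(`divides_wreath_derivedSemigroup`). A semigroup `D(ρ)` of complexity at most one divides some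
`A ⋊ (G ⋊ B)` with `A`, `B` aperiodic and `G` a group, and `(A ⋊ X) ≀ T` embeds into
`A^J ⋊ (X ≀ T)` with `J = T ∪ {1}`. Hence `D(ρ) ≀ T` lies in `A ∗ G ∗ (A ∗ Cₙ)`, and it remains to
see that `A ∗ Cₙ ⊆ Cₙ` (`complexityClass_of_mem_aperiodicStar`). For this the projection
`A ⋊ (B ⋊ Y) → Y`, with `A` and `B` aperiodic, is shown to have an aperiodic derived semigroup:
a loop fixes the `Y`-component of the elements over its object, so that the components in `B` and
then in `A` stabilize under its powers. The derived semigroup theorem then gives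
`A ∗ (A ∗ W) ⊆ A ∗ W`.

Conversely a member of `Cₙ₊₁` divides some `A ⋊ (G ⋊ T)` with `T` in `Cₙ`. For the relational
morphism to `T` that this division induces, an arrow at `t` given by `(p, (g, t'))` is determined
by its end points, the function `h ↦ (h, t) p` on `G`, and the element `t g` of `G`. These
labels multiply as in the wreath product of `A ∪ {1}` and `G`, so `D(ρ)` divides the product of
this wreath product and of the consolidation of the codiscrete category on `T ∪ {1}`, which is
aperiodic (`divides_derivedSemigroup_toBase`).
-/

namespace KrohnRhodes

open CategoryTheory Filter

/-! ### Stabilization of powers and aperiodicity -/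

/-- The sequence `z, z x, (z x) x, …` is eventually constant. In this form, which needs no powers,
the condition `xⁿ⁺¹ = xⁿ` makes sense relative to a starting element `z` and passes through
semidirect products one factor at a time. -/
def Stabilizes {S : Type u} [Semigroup S] (z x : S) : Prop :=
  ∃ N : ℕ, (· * x)^[N] z * x = (· * x)^[N] z

section Stabilizes

variable {S : Type u} {T : Type v} [Semigroup S] [Semigroup T]

theorem map_iterate_mul (f : S →ₙ* T) (z x : S) (N : ℕ) :
    f ((· * x)^[N] z) = (· * f x)^[N] (f z) :=
  (Function.Semiconj.iterate_right (f := f) (fun a => by simp) N) z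

theorem mul_iterate_mul (w z x : S) (N : ℕ) :
    w * (· * x)^[N] z = (· * x)^[N] (w * z) :=
  (Function.Semiconj.iterate_right (f := (w * ·)) (fun a => (mul_assoc w a x).symm) N) z

theorem Stabilizes.eventually {z x : S} (h : Stabilizes z x) :
    ∀ᶠ N in atTop, (· * x)^[N] z * x = (· * x)^[N] z := by
  obtain ⟨N, hN⟩ := h
  refine eventually_atTop.2 ⟨N, fun M hM => ?_⟩
  induction M, hM using Nat.le_induction with
  | base => exact hN
  | succ k _ ih => rw [Function.iterate_succ_apply', ih]; exact ih

theorem Stabilizes.map {z x : S} (h : Stabilizes z x) (f : S →ₙ* T) :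
    Stabilizes (f z) (f x) := by
  obtain ⟨N, hN⟩ := h
  exact ⟨N, by rw [← map_iterate_mul, ← map_mul, hN]⟩

theorem Stabilizes.of_map {z x : S} {f : S →ₙ* T} (hf : Function.Injective f)
    (h : Stabilizes (f z) (f x)) : Stabilizes z x := by
  obtain ⟨N, hN⟩ := h
  exact ⟨N, hf (by rw [map_mul, map_iterate_mul, hN])⟩

theorem Stabilizes.of_iterate {z x : S} (K : ℕ) (h : Stabilizes ((· * x)^[K] z) x) :
    Stabilizes z x := by
  obtain ⟨N, hN⟩ := h
  exact ⟨N + K, by rw [Function.iterate_add_apply, hN]⟩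

theorem Stabilizes.mul_left {z x : S} (h : Stabilizes z x) (w : S) : Stabilizes (w * z) x := by
  obtain ⟨N, hN⟩ := h
  exact ⟨N, by rw [← mul_iterate_mul, mul_assoc, hN]⟩

theorem Stabilizes.of_self {x : S} (h : Stabilizes x x) (z : S) : Stabilizes z x :=
  .of_iterate 1 (h.mul_left z)

theorem Stabilizes.of_mul_eq {z x : S} (h : z * x = z) : Stabilizes z x := ⟨0, h⟩

theorem Stabilizes.prod {z x : S × T} (h₁ : Stabilizes z.1 x.1) (h₂ : Stabilizes z.2 x.2) :
    Stabilizes z x := by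
  obtain ⟨N, h₁, h₂⟩ := (h₁.eventually.and h₂.eventually).exists
  refine ⟨N, Prod.ext ?_ ?_⟩
  · have := map_iterate_mul (MulHom.fst S T) z x N
    simp only [MulHom.coe_fst] at this
    rw [Prod.fst_mul, this, h₁]
  · have := map_iterate_mul (MulHom.snd S T) z x N
    simp only [MulHom.coe_snd] at this
    rw [Prod.snd_mul, this, h₂]

/-- Once the `T`-component has stabilized, right multiplication by `x` translates the
`S`-component by one fixed element. -/
theorem Stabilizes.semidirect (β : LeftAction T S) (hS : ∀ s : S, Stabilizes s s)
    {z x : Semidirect β} (h : Stabilizes z.right x.right) : Stabilizes z x := by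
  obtain ⟨N, hN⟩ := h
  have hr : ∀ M, ((· * x)^[M] z).right = (· * x.right)^[M] z.right := fun M =>
    (Function.Semiconj.iterate_right (f := Semidirect.right) (fun _ => rfl) M) z
  rw [← hr] at hN
  refine .of_iterate N ?_
  generalize (· * x)^[N] z = z' at hN
  obtain ⟨q, t⟩ := z'
  have key : ∀ M, (· * x)^[M] (⟨q, t⟩ : Semidirect β) =
      ⟨(· * β.act t x.left)^[M] q, t⟩ := by
    intro M
    induction M with
    | zero => rfl
    | succ M ih =>
      rw [Function.iterate_succ_apply', Function.iterate_succ_apply', ih]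
      exact Semidirect.ext rfl hN
  obtain ⟨M, hM⟩ := (hS (β.act t x.left)).of_self q
  refine ⟨M, ?_⟩
  rw [key]
  exact Semidirect.ext hM hN

end Stabilizes

/-- The quotient of `G` by the kernel of `f` is a group that embeds into `S`. -/
theorem IsAperiodic.map_eq_map_one {S : Type u} [Semigroup S] (hS : IsAperiodic S)
    {G : Type u} [Group G] (f : G →ₙ* S) (g : G) : f g = f 1 := by
  let c : Con G := Con.ker f
  let F : c.Quotient →ₙ* S :=
    { toFun := fun q => Con.liftOn q f fun a b h => h
      map_mul' := by
        rintro ⟨a⟩ ⟨b⟩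
        exact map_mul f a b }
  have hF : Function.Injective F := by
    rintro ⟨a⟩ ⟨b⟩ h
    exact Quotient.sound h
  have := hS.2 c.Quotient F hF
  exact c.eq.1 (Subsingleton.elim (g : c.Quotient) ((1 : G) : c.Quotient))

theorem isAperiodic_iff {S : Type u} [Semigroup S] :
    IsAperiodic S ↔ Finite S ∧ ∀ x : S, Stabilizes x x := by
  refine ⟨fun h => ⟨h.1, fun x => ?_⟩, fun h => ⟨h.1, fun G _ f hf => ?_⟩⟩
  · have := h.1
    let pw : ℕ → S := fun k => (· * x)^[k] x
    have pw_succ (k : ℕ) : pw (k + 1) = pw k * x := Function.iterate_succ_apply' ..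
    have pw_mul (i j : ℕ) : pw i * pw j = pw (i + j + 1) := by
      induction j with
      | zero => exact (pw_succ i).symm
      | succ j ih => rw [pw_succ, ← mul_assoc, ih, ← add_assoc, pw_succ (i + j + 1)]
    obtain ⟨i, p, hp, hip⟩ : ∃ i p, 0 < p ∧ pw (i + p) = pw i := by
      obtain ⟨a, b, hab, h⟩ := Finite.exists_ne_map_eq_of_infinite pw
      rcases lt_or_gt_of_ne hab with hlt | hlt
      · exact ⟨a, b - a, by omega, by rw [Nat.add_sub_cancel' hlt.le, h]⟩
      · exact ⟨b, a - b, by omega, by rw [Nat.add_sub_cancel' hlt.le, h]⟩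
    have hper (j : ℕ) (hj : i ≤ j) : pw (j + p) = pw j := by
      induction j, hj using Nat.le_induction with
      | base => exact hip
      | succ k _ ih => rw [add_right_comm, pw_succ, ih, pw_succ]
    -- `M + 1` is a multiple of the period that exceeds the index, so `pw M` is idempotent and
    -- the powers from `pw M` on form a cyclic group.
    obtain ⟨M, hM⟩ : ∃ M, M + 1 = p * (i + 1) :=
      ⟨p * (i + 1) - 1, Nat.sub_add_cancel (Nat.mul_pos hp i.succ_pos)⟩
    have hiM : i ≤ M := by nlinarith
    have hmul (c m : ℕ) : pw (M + (m + p * c)) = pw (M + m) := by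
      induction c with
      | zero => rfl
      | succ c ih => rw [mul_add_one, ← add_assoc, ← add_assoc, hper _ (by omega), add_assoc, ih]
    have hg : Function.Periodic (fun m => pw (M + m)) (M + 1) := fun m => by
      simp only [hM, hmul]
    let f : ULift.{u} (Multiplicative (ZMod (M + 1))) →ₙ* S :=
      { toFun := fun k => pw (M + (ZMod.val k.down.toAdd))
        map_mul' := by
          rintro ⟨a⟩ ⟨b⟩
          change pw (M + ZMod.val (a.toAdd + b.toAdd)) = _
          rw [ZMod.val_add, hg.map_mod_nat, pw_mul]
          have := hg (a.toAdd.val + b.toAdd.val)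
          simp only at this
          rw [← this]
          congr 1
          ring }
    have h1 : pw (M + ZMod.val (1 : ZMod (M + 1))) = pw (M + ZMod.val (0 : ZMod (M + 1))) :=
      h.map_eq_map_one f ⟨Multiplicative.ofAdd 1⟩
    rw [ZMod.val_one_eq_one_mod, hg.map_mod_nat, ZMod.val_zero] at h1
    exact ⟨M, (pw_succ M).symm.trans h1⟩
  · have key (g : G) : g = 1 := by
      obtain ⟨N, hN⟩ := (h.2 (f g)).of_map hf
      exact mul_eq_left.1 hN
    exact ⟨fun a b => (key a).trans (key b).symm⟩

theorem IsAperiodic.stabilizes {S : Type u} [Semigroup S] (hS : IsAperiodic S) (z x : S) :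
    Stabilizes z x :=
  ((isAperiodic_iff.1 hS).2 x).of_self z

theorem finite_withOne (T : Type u) [Finite T] : Finite (WithOne T) :=
  inferInstanceAs (Finite (Option T))

theorem IsAperiodic.withOne {S : Type u} [Semigroup S] (hS : IsAperiodic S) :
    IsAperiodic (WithOne S) := by
  have := hS.1
  refine isAperiodic_iff.2 ⟨finite_withOne S, fun x => ?_⟩
  induction x using WithOne.recOneCoe with
  | one => exact .of_mul_eq (mul_one 1)
  | coe x => exact (hS.stabilizes x x).map WithOne.coeMulHom

theorem finite_semidirect {T : Type u} {S : Type v} [Semigroup T] [Semigroup S]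
    (β : LeftAction T S) [Finite S] [Finite T] : Finite (Semidirect β) :=
  Finite.of_injective (fun x => (x.left, x.right)) fun _ _ h =>
    Semidirect.ext (congrArg Prod.fst h) (congrArg Prod.snd h)

theorem IsAperiodic.semidirect {T S : Type u} [Semigroup T] [Semigroup S]
    (hS : IsAperiodic S) (hT : IsAperiodic T) (β : LeftAction T S) :
    IsAperiodic (Semidirect β) := by
  have := hS.1
  have := hT.1
  exact isAperiodic_iff.2 ⟨finite_semidirect β, fun x =>
    .semidirect β (fun s => hS.stabilizes s s) (hT.stabilizes _ _)⟩

theorem finite_consolidation (C : Type v) [Category.{w} C] [Finite C]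
    [∀ X Y : C, Finite (X ⟶ Y)] : Finite (Consolidation C) := by
  refine Finite.of_surjective
    (fun o : Option (Σ X : C, Σ Y : C, X ⟶ Y) =>
      o.elim Consolidation.zero fun f => Consolidation.arrow f.2.2) ?_
  rintro (_ | ⟨f⟩)
  · exact ⟨none, rfl⟩
  · exact ⟨some ⟨_, _, f⟩, rfl⟩

theorem Consolidation.arrow_mul_arrow {C : Type v} [Category.{w} C] {X Y Z : C}
    (f : X ⟶ Y) (g : Y ⟶ Z) : arrow f * arrow g = arrow (f ≫ g) := by
  change Consolidation.mul _ _ = _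
  simp [Consolidation.mul]

theorem Consolidation.arrow_mul_arrow_of_ne {C : Type v} [Category.{w} C] {X Y Y' Z : C}
    (h : Y ≠ Y') (f : X ⟶ Y) (g : Y' ⟶ Z) : arrow f * arrow g = zero := by
  change Consolidation.mul _ _ = _
  simp [Consolidation.mul, h]

theorem Consolidation.zero_mul {C : Type v} [Category.{w} C] (x : Consolidation C) :
    zero * x = zero := by
  cases x <;> rfl

theorem Consolidation.mul_zero {C : Type v} [Category.{w} C] (x : Consolidation C) :
    x * zero = zero := by
  cases x <;> rfl

/-- Only the local semigroups matter: the square of an arrow that is not a loop is zero. -/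
theorem isAperiodic_consolidation {C : Type v} [Category.{w} C] [Finite C]
    [∀ X Y : C, Finite (X ⟶ Y)]
    (h : ∀ (X : C) (f : X ⟶ X), ∃ N : ℕ, (· ≫ f)^[N] f ≫ f = (· ≫ f)^[N] f) :
    IsAperiodic (Consolidation C) := by
  refine isAperiodic_iff.2 ⟨finite_consolidation C, fun x => ?_⟩
  rcases x with _ | @⟨X, Y, f⟩
  · exact .of_mul_eq (Consolidation.zero_mul _)
  by_cases hXY : Y = X
  · subst hXY
    obtain ⟨N, hN⟩ := h _ f
    have key (M : ℕ) : (· * Consolidation.arrow f)^[M] (Consolidation.arrow f) =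
        Consolidation.arrow ((· ≫ f)^[M] f) := by
      induction M with
      | zero => rfl
      | succ M ih =>
        rw [Function.iterate_succ_apply', Function.iterate_succ_apply', ih,
          Consolidation.arrow_mul_arrow]
    exact ⟨N, by rw [key, Consolidation.arrow_mul_arrow, hN]⟩
  · refine .of_iterate 1 (.of_mul_eq ?_)
    simp only [Function.iterate_one, Consolidation.arrow_mul_arrow_of_ne hXY,
      Consolidation.zero_mul]

/-! ### Division and pseudovarieties -/

/-- `S` divides `T`: some relational morphism from `S` to `T` has pairwise disjoint values.
Equivalently, `S` is a homomorphic image of a subsemigroup of `T`. -/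
def Divides (S : Type u) (T : Type v) [Semigroup S] [Semigroup T] : Prop :=
  ∃ δ : RelationalMorphism S T, ∀ {s s' t}, t ∈ δ.rel s → t ∈ δ.rel s' → s = s'

section Divides

variable {S : Type u} {T : Type v} {U : Type w} [Semigroup S] [Semigroup T] [Semigroup U]

/-- The composite of two relational morphisms. -/
def RelationalMorphism.comp (ρ : RelationalMorphism S T) (σ : RelationalMorphism T U) :
    RelationalMorphism S U where
  rel s := {x | ∃ t ∈ ρ.rel s, x ∈ σ.rel t}
  nonempty s := by
    obtain ⟨t, ht⟩ := ρ.nonempty s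
    obtain ⟨x, hx⟩ := σ.nonempty t
    exact ⟨x, t, ht, hx⟩
  mul_mem := by
    rintro s s' x x' ⟨t, ht, hx⟩ ⟨t', ht', hx'⟩
    exact ⟨t * t', ρ.mul_mem ht ht', σ.mul_mem hx hx'⟩

/-- A homomorphism, regarded as a relational morphism. -/
def RelationalMorphism.ofHom (f : S →ₙ* T) : RelationalMorphism S T where
  rel s := {f s}
  nonempty s := ⟨f s, rfl⟩
  mul_mem := by
    rintro s s' _ _ rfl rfl
    exact (map_mul f s s').symm

theorem Divides.trans (h : Divides S T) (h' : Divides T U) : Divides S U := by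
  obtain ⟨δ, hδ⟩ := h
  obtain ⟨ε, hε⟩ := h'
  refine ⟨δ.comp ε, ?_⟩
  rintro s s' x ⟨t, ht, hx⟩ ⟨t', ht', hx'⟩
  obtain rfl := hε hx hx'
  exact hδ ht ht'

theorem Divides.of_injective (f : S →ₙ* T) (hf : Function.Injective f) : Divides S T :=
  ⟨.ofHom f, fun h h' => hf (h.symm.trans h')⟩

theorem Divides.of_surjective (f : T →ₙ* S) (hf : Function.Surjective f) : Divides S T :=
  ⟨{ rel := fun s => {t | f t = s}
     nonempty := hf
     mul_mem := by
      rintro _ _ t t' rfl rfl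
      exact map_mul f t t' }, fun h h' => h.symm.trans h'⟩

theorem Divides.prod {S' T' : Type*} [Semigroup S'] [Semigroup T'] (h : Divides S T)
    (h' : Divides S' T') : Divides (S × S') (T × T') := by
  obtain ⟨δ, hδ⟩ := h
  obtain ⟨ε, hε⟩ := h'
  exact ⟨{ rel := fun s => {t | t.1 ∈ δ.rel s.1 ∧ t.2 ∈ ε.rel s.2}
           nonempty := fun s => ⟨(_, _), (δ.nonempty s.1).some_mem, (ε.nonempty s.2).some_mem⟩
           mul_mem := fun h h' => ⟨δ.mul_mem h.1 h'.1, ε.mul_mem h.2 h'.2⟩ },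
    fun h h' => Prod.ext (hδ h.1 h'.1) (hε h.2 h'.2)⟩

theorem Divides.finite [Finite T] (h : Divides S T) : Finite S := by
  obtain ⟨δ, hδ⟩ := h
  refine Finite.of_injective (fun s => (δ.nonempty s).some) fun s s' h => ?_
  exact hδ (δ.nonempty s).some_mem ((congrArg (· ∈ δ.rel s') h).mpr (δ.nonempty s').some_mem)

end Divides

theorem IsPseudovariety.of_divides {P : SemigroupClass.{u}} (hP : IsPseudovariety P)
    {S T : Type u} [Semigroup S] [Semigroup T] (h : Divides S T) (hT : P T) : P S := by
  obtain ⟨δ, hδ⟩ := h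
  let R : Subsemigroup (S × T) :=
    { carrier := {p | p.2 ∈ δ.rel p.1}
      mul_mem' := fun h h' => δ.mul_mem h h' }
  refine hP.quotient R S ((MulHom.fst S T).comp (MulMemClass.subtype R)) ?_
    (hP.sub R T ((MulHom.snd S T).comp (MulMemClass.subtype R)) ?_ hT)
  · intro s
    exact ⟨⟨(s, _), (δ.nonempty s).some_mem⟩, rfl⟩
  · rintro ⟨⟨s, t⟩, h⟩ ⟨⟨s', t'⟩, h'⟩ (rfl : t = t')
    exact Subtype.ext (Prod.ext (hδ h h') rfl)

theorem IsPseudovariety.pi {P : SemigroupClass.{u}} (hP : IsPseudovariety P)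
    {S : Type u} [Semigroup S] (hS : P S) (J : Type u) [Finite J] : P (J → S) := by
  induction J using Finite.induction_empty_option with
  | of_equiv e h =>
    refine hP.of_divides (.of_injective ⟨fun f a => f (e a), fun _ _ => rfl⟩ ?_) h
    intro f g hfg
    funext b
    simpa using congrFun hfg (e.symm b)
  | h_empty =>
    exact hP.of_divides (.of_injective ⟨fun _ => PUnit.unit, fun _ _ => rfl⟩
      fun f g _ => funext fun a => a.elim) hP.unit
  | h_option h =>
    refine hP.of_divides (.of_injective ⟨fun f => (f none, fun a => f (some a)),
      fun _ _ => rfl⟩ ?_) (hP.prod _ _ hS h)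
    intro f g hfg
    funext a
    cases a with
    | none => exact congrArg Prod.fst hfg
    | some a => exact congrFun (congrArg Prod.snd hfg) a

theorem isPseudovariety_finite : IsPseudovariety.{u} (fun S _ => Finite S) where
  finite _ _ h := h
  unit := inferInstance
  prod _ _ _ _ _ _ := inferInstance
  sub _ _ _ _ f hf _ := Finite.of_injective f hf
  quotient _ _ _ _ f hf _ := Finite.of_surjective f hf

theorem isPseudovariety_isAperiodic : IsPseudovariety.{u} (fun S _ => IsAperiodic S) where
  finite _ _ h := h.1
  unit := isAperiodic_iff.2 ⟨inferInstance, fun _ => ⟨0, rfl⟩⟩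
  prod S T _ _ hS hT := by
    have := hS.1
    have := hT.1
    exact isAperiodic_iff.2 ⟨inferInstance, fun _ =>
      .prod (hS.stabilizes _ _) (hT.stabilizes _ _)⟩
  sub S T _ _ f hf hT := by
    have := hT.1
    exact isAperiodic_iff.2 ⟨.of_injective f hf, fun _ => .of_map hf (hT.stabilizes _ _)⟩
  quotient S T _ _ f hf hS := by
    have := hS.1
    refine isAperiodic_iff.2 ⟨.of_surjective f hf, fun t => ?_⟩
    obtain ⟨s, rfl⟩ := hf t
    exact (hS.stabilizes s s).map f

theorem isFiniteGroup_of_group (G : Type u) [Group G] [Finite G] : IsFiniteGroup G :=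
  ⟨inferInstance, G, inferInstance, ⟨MulEquiv.refl G⟩⟩

theorem IsFiniteGroup.prod {G H : Type u} [Semigroup G] [Semigroup H] (hG : IsFiniteGroup G)
    (hH : IsFiniteGroup H) : IsFiniteGroup (G × H) := by
  obtain ⟨_, G', _, ⟨e⟩⟩ := hG
  obtain ⟨_, H', _, ⟨e'⟩⟩ := hH
  exact ⟨inferInstance, G' × H', Prod.instGroup,
    ⟨⟨e.toEquiv.prodCongr e'.toEquiv, fun _ _ => Prod.ext (map_mul e _ _) (map_mul e' _ _)⟩⟩⟩

theorem IsFiniteGroup.pi {G : Type u} [Semigroup G] (hG : IsFiniteGroup G) (J : Type u)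
    [Finite J] : IsFiniteGroup (J → G) := by
  obtain ⟨_, G', _, ⟨e⟩⟩ := hG
  exact ⟨inferInstance, J → G', Pi.group, ⟨.piCongrRight fun _ => e⟩⟩

theorem IsFiniteGroup.exists_group {G : Type u} [inst : Semigroup G] (hG : IsFiniteGroup G) :
    ∃ g : Group G, g.toMonoid.toSemigroup = inst := by
  obtain ⟨_, G', _, ⟨e⟩⟩ := hG
  refine ⟨{ inst with
    one := e.symm 1
    inv := fun x => e.symm (e x)⁻¹
    one_mul := fun x => e.injective ?_
    mul_one := fun x => e.injective ?_
    inv_mul_cancel := fun x => e.injective ?_ }, rfl⟩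
  · exact (map_mul e (e.symm 1) x).trans (by simp)
  · exact (map_mul e x (e.symm 1)).trans (by simp)
  · exact (map_mul e (e.symm (e x)⁻¹) x).trans
      ((by simp : e (e.symm (e x)⁻¹) * e x = 1).trans (e.apply_symm_apply 1).symm)

/-! ### The operation `V ∗ W` -/

theorem semidirect_mem_star {V W : SemigroupClass.{u}} {S T : Type u} [Semigroup S]
    [Semigroup T] (β : LeftAction T S) (hS : V S) (hT : W T) : star V W (Semidirect β) :=
  fun _ _ h => h S T β hS hT

theorem isPseudovariety_star {V W : SemigroupClass.{u}}
    (hV : ∀ (S : Type u) [Semigroup S], V S → Finite S)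
    (hW : ∀ (S : Type u) [Semigroup S], W S → Finite S) : IsPseudovariety (star V W) where
  finite S _ h := h _ isPseudovariety_finite fun S T _ _ β hS hT => by
    have := hV S hS
    have := hW T hT
    exact finite_semidirect β
  unit P hP _ := hP.unit
  prod S T _ _ hS hT P hP h := hP.prod S T (hS P hP h) (hT P hP h)
  sub S T _ _ f hf hT P hP h := hP.sub S T f hf (hT P hP h)
  quotient S T _ _ f hf hS P hP h := hP.quotient S T f hf (hS P hP h)

/-- If `V` and `W` are closed under finite products then the divisors of the semidirect products
already form a pseudovariety. Closure under subsemigroups is not assumed, because the class of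
finite groups lacks it (it does not contain the empty semigroup). -/
theorem exists_divides_of_mem_star {V W : SemigroupClass.{u}}
    (hV : ∀ (S : Type u) [Semigroup S], V S → Finite S)
    (hW : ∀ (S : Type u) [Semigroup S], W S → Finite S)
    (hV₁ : V PUnit.{u + 1}) (hW₁ : W PUnit.{u + 1})
    (hV₂ : ∀ (S T : Type u) [Semigroup S] [Semigroup T], V S → V T → V (S × T))
    (hW₂ : ∀ (S T : Type u) [Semigroup S] [Semigroup T], W S → W T → W (S × T))
    {U : Type u} [Semigroup U] (hU : star V W U) :
    ∃ (S T : Type u) (_ : Semigroup S) (_ : Semigroup T) (β : LeftAction T S),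
      V S ∧ W T ∧ Divides U (Semidirect β) := by
  refine hU (fun U _ => ∃ (S T : Type u) (_ : Semigroup S) (_ : Semigroup T)
    (β : LeftAction T S), V S ∧ W T ∧ Divides U (Semidirect β)) ⟨?_, ?_, ?_, ?_, ?_⟩ ?_
  · rintro U _ ⟨S, T, _, _, β, hS, hT, h⟩
    have := hV S hS
    have := hW T hT
    have := finite_semidirect β
    exact h.finite
  · exact ⟨PUnit, PUnit, inferInstance, inferInstance,
      ⟨fun _ s => s, fun _ _ _ => rfl, fun _ _ _ => rfl⟩, hV₁, hW₁,
      .of_injective ⟨fun _ => ⟨PUnit.unit, PUnit.unit⟩, fun _ _ => rfl⟩ fun _ _ _ => rfl⟩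
  · rintro U U' _ _ ⟨S, T, _, _, β, hS, hT, h⟩ ⟨S', T', _, _, β', hS', hT', h'⟩
    refine ⟨S × S', T × T', inferInstance, inferInstance,
      ⟨fun t s => (β.act t.1 s.1, β'.act t.2 s.2),
        fun _ _ _ => Prod.ext (β.mul_act ..) (β'.mul_act ..),
        fun _ _ _ => Prod.ext (β.act_mul ..) (β'.act_mul ..)⟩, hV₂ _ _ hS hS', hW₂ _ _ hT hT',
      (h.prod h').trans (.of_injective
        ⟨fun x => ⟨(x.1.left, x.2.left), (x.1.right, x.2.right)⟩, fun _ _ => rfl⟩ ?_)⟩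
    rintro ⟨⟨a, b⟩, c, d⟩ ⟨⟨a', b'⟩, c', d'⟩ h
    simpa [and_assoc, and_left_comm] using h
  · rintro U U' _ _ f hf ⟨S, T, _, _, β, hS, hT, h⟩
    exact ⟨S, T, _, _, β, hS, hT, (Divides.of_injective f hf).trans h⟩
  · rintro U U' _ _ f hf ⟨S, T, _, _, β, hS, hT, h⟩
    exact ⟨S, T, _, _, β, hS, hT, (Divides.of_surjective f hf).trans h⟩
  · intro S T _ _ β hS hT
    exact ⟨S, T, _, _, β, hS, hT, .of_injective (MulHom.id _) Function.injective_id⟩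

theorem mem_star_of_mem_left {V W : SemigroupClass.{u}} (h : IsPseudovariety (star V W))
    (hW : W PUnit.{u + 1}) {S : Type u} [Semigroup S] (hS : V S) : star V W S :=
  h.of_divides (.of_injective ⟨fun s => ⟨s, PUnit.unit⟩, fun _ _ => rfl⟩
      fun _ _ h => congrArg Semidirect.left h)
    (semidirect_mem_star (T := PUnit.{u + 1})
      ⟨fun _ s => s, fun _ _ _ => rfl, fun _ _ _ => rfl⟩ hS hW)

theorem mem_star_of_mem_right {V W : SemigroupClass.{u}} (h : IsPseudovariety (star V W))
    (hV : V PUnit.{u + 1}) {T : Type u} [Semigroup T] (hT : W T) : star V W T :=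
  h.of_divides (.of_injective ⟨fun t => ⟨PUnit.unit, t⟩, fun _ _ => rfl⟩
      fun _ _ h => congrArg Semidirect.right h)
    (semidirect_mem_star (S := PUnit.{u + 1})
      ⟨fun _ s => s, fun _ _ _ => rfl, fun _ _ _ => rfl⟩ hV hT)

/-- The class `G ∗ W` for a pseudovariety `W`. -/
abbrev groupStar (W : SemigroupClass.{u}) : SemigroupClass.{u} :=
  star (fun S _ => IsFiniteGroup S) W

/-- The class `A ∗ W` for a pseudovariety `W`. -/
abbrev aperiodicStar (W : SemigroupClass.{u}) : SemigroupClass.{u} :=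
  star (fun S _ => IsAperiodic S) W

theorem IsPseudovariety.groupStar {W : SemigroupClass.{u}} (hW : IsPseudovariety W) :
    IsPseudovariety (groupStar W) :=
  isPseudovariety_star (fun _ _ h => h.1) hW.finite

theorem IsPseudovariety.aperiodicStar {W : SemigroupClass.{u}} (hW : IsPseudovariety W) :
    IsPseudovariety (aperiodicStar W) :=
  isPseudovariety_star (fun _ _ h => h.1) hW.finite

theorem exists_divides_of_mem_groupStar {W : SemigroupClass.{u}} (hW : IsPseudovariety W)
    {U : Type u} [Semigroup U] (hU : groupStar W U) :
    ∃ (G T : Type u) (_ : Group G) (_ : Semigroup T) (β : LeftAction T G),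
      Finite G ∧ W T ∧ Divides U (Semidirect β) := by
  obtain ⟨G, T, _, _, β, hG, hT, h⟩ := exists_divides_of_mem_star (fun _ _ h => h.1) hW.finite
    (isFiniteGroup_of_group PUnit) hW.unit (fun _ _ _ _ h h' => h.prod h') hW.prod hU
  obtain ⟨g, rfl⟩ := hG.exists_group
  exact ⟨G, T, g, _, β, hG.1, hT, h⟩

theorem exists_divides_of_mem_aperiodicStar {W : SemigroupClass.{u}} (hW : IsPseudovariety W)
    {U : Type u} [Semigroup U] (hU : aperiodicStar W U) :
    ∃ (S T : Type u) (_ : Semigroup S) (_ : Semigroup T) (β : LeftAction T S),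
      IsAperiodic S ∧ W T ∧ Divides U (Semidirect β) :=
  have hA := isPseudovariety_isAperiodic
  exists_divides_of_mem_star hA.finite hW.finite hA.unit hW.unit hA.prod hW.prod hU

theorem isPseudovariety_complexityClass (n : ℕ) : IsPseudovariety.{u} (complexityClass n) := by
  induction n with
  | zero => exact isPseudovariety_isAperiodic
  | succ n ih => exact ih.groupStar.aperiodicStar

theorem complexityClass_mono {m n : ℕ} (h : m ≤ n) {S : Type u} [Semigroup S]
    (hS : complexityClass m S) : complexityClass n S := by
  induction n, h using Nat.le_induction with
  | base => exact hS
  | succ n _ ih =>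
    have hn := isPseudovariety_complexityClass.{u} n
    exact mem_star_of_mem_right hn.groupStar.aperiodicStar isPseudovariety_isAperiodic.unit
      (mem_star_of_mem_right hn.groupStar (isFiniteGroup_of_group PUnit) ih)

theorem complexity_le_iff {S : Type u} [Semigroup S] {n : ℕ} :
    complexity S ≤ (n : ℕ∞) ↔ complexityClass n S := by
  refine ⟨fun h => ?_, fun h => sInf_le ⟨n, rfl, h⟩⟩
  have hne : {m : ℕ∞ | ∃ n : ℕ, m = n ∧ complexityClass n S}.Nonempty := by
    by_contra hne
    rw [Set.not_nonempty_iff_eq_empty] at hne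
    rw [complexity, hne, sInf_empty] at h
    exact ENat.natCast_ne_top n (top_le_iff.1 h)
  obtain ⟨m, hm, hS⟩ := csInf_mem hne
  rw [complexity, hm, Nat.cast_le] at h
  exact complexityClass_mono h hS

/-! ### Wreath products -/

/-- The action of `T` on functions on `T ∪ {1}` by translation of the argument. -/
def translation (T : Type u) (X : Type v) [Semigroup T] [Semigroup X] :
    LeftAction T (WithOne T → X) where
  act t f a := f (a * t)
  mul_act t t' f := funext fun a => by
    rw [WithOne.coe_mul, ← mul_assoc]
  act_mul _ _ _ := rfl

/-- The wreath product of `X` and `T`: the semidirect product of the functions from `T ∪ {1}` to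
`X` with `T`. -/
abbrev Wreath (X : Type v) (T : Type u) [Semigroup X] [Semigroup T] :=
  Semidirect (translation T X)

theorem Divides.wreath {X Y T : Type u} [Semigroup X] [Semigroup Y] [Semigroup T]
    (h : Divides X Y) : Divides (Wreath X T) (Wreath Y T) := by
  obtain ⟨δ, hδ⟩ := h
  refine ⟨{ rel := fun x => {y | (∀ a, y.left a ∈ δ.rel (x.left a)) ∧ y.right = x.right}
            nonempty := fun x =>
              ⟨⟨fun a => (δ.nonempty (x.left a)).some, x.right⟩,
                fun a => (δ.nonempty (x.left a)).some_mem, rfl⟩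
            mul_mem := ?_ }, ?_⟩
  · rintro x x' y y' ⟨h, hr⟩ ⟨h', hr'⟩
    refine ⟨fun a => δ.mul_mem (h a) ?_, congrArg₂ (· * ·) hr hr'⟩
    rw [hr]
    exact h' _
  · rintro x x' y ⟨h, hr⟩ ⟨h', hr'⟩
    exact Semidirect.ext (funext fun a => hδ (h a) (h' a)) (hr.symm.trans hr')

/-- The action through which `(S ⋊ X) ≀ T` embeds into `S^J ⋊ (X ≀ T)`, where `J = T ∪ {1}`. -/
def LeftAction.wreath {S X : Type u} [Semigroup S] [Semigroup X] (β : LeftAction X S)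
    (T : Type u) [Semigroup T] : LeftAction (Wreath X T) (WithOne T → S) where
  act z f a := β.act (z.left a) (f (a * z.right))
  mul_act z z' f := funext fun a => by
    change β.act (z.left a * z'.left (a * z.right)) (f (a * ↑(z.right * z'.right))) = _
    rw [β.mul_act, WithOne.coe_mul, ← mul_assoc]
  act_mul _ _ _ := funext fun _ => β.act_mul _ _ _

theorem divides_wreath_semidirect {S X : Type u} [Semigroup S] [Semigroup X]
    (β : LeftAction X S) (T : Type u) [Semigroup T] :
    Divides (Wreath (Semidirect β) T) (Semidirect (β.wreath T)) := by
  refine .of_injective ⟨fun x => ⟨fun a => (x.left a).left, ⟨fun a => (x.left a).right, x.right⟩⟩,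
    fun _ _ => rfl⟩ ?_
  rintro ⟨f, t⟩ ⟨g, t'⟩ h
  have h₁ := congrArg Semidirect.left h
  have h₂ := congrArg Semidirect.right h
  exact Semidirect.ext
    (funext fun a => Semidirect.ext (congrFun h₁ a) (congrFun (congrArg Semidirect.left h₂) a))
    (congrArg Semidirect.right h₂ :)

/-- The right factor of a semidirect product can be replaced by a multiple of it, at the cost of
a direct power of the left factor: a function on `Y ∪ {1}` records the translates of an element
of `S` under `X`. -/
theorem divides_wreath_of_divides {S X Y : Type u} [Semigroup S] [Semigroup X] [Semigroup Y]
    (β : LeftAction X S) (h : Divides X Y) : Divides (Semidirect β) (Wreath S Y) := by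
  obtain ⟨δ, hδ⟩ := h
  refine ⟨{ rel := fun z => {w | w.right ∈ δ.rel z.right ∧ w.left 1 = z.left ∧
              ∀ x, ∀ y ∈ δ.rel x, w.left (y : WithOne Y) = β.act x z.left}
            nonempty := ?_
            mul_mem := ?_ }, ?_⟩
  · classical
    rintro ⟨s, x⟩
    obtain ⟨y, hy⟩ := δ.nonempty x
    refine ⟨⟨WithOne.recOneCoe s fun y' =>
      if h : ∃ x', y' ∈ δ.rel x' then β.act h.choose s else s, y⟩, hy, rfl, fun x' y' hy' => ?_⟩
    have hex : ∃ x', y' ∈ δ.rel x' := ⟨x', hy'⟩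
    change dite _ _ _ = _
    rw [dif_pos hex, hδ hex.choose_spec hy']
  · rintro z z' w w' ⟨hr, h1, hl⟩ ⟨hr', h1', hl'⟩
    refine ⟨δ.mul_mem hr hr', ?_, fun x y hy => ?_⟩
    · change w.left 1 * w'.left (1 * w.right) = z.left * β.act z.right z'.left
      rw [one_mul, h1, hl' _ _ hr]
    · change w.left y * w'.left (y * w.right) = β.act x (z.left * β.act z.right z'.left)
      rw [hl _ _ hy, ← WithOne.coe_mul, hl' _ _ (δ.mul_mem hy hr), β.act_mul, β.mul_act]
  · rintro z z' w ⟨hr, h1, -⟩ ⟨hr', h1', -⟩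
    exact Semidirect.ext (h1.symm.trans h1') (hδ hr hr')

/-! ### The derived semigroup -/

section Derived

variable {S : Type u} {T : Type v} [Semigroup S] [Semigroup T]

theorem RelationalMorphism.one_mem_relOne_iff (ρ : RelationalMorphism S T) {x : WithOne S} :
    (1 : WithOne T) ∈ ρ.relOne x ↔ x = 1 := by
  refine ⟨?_, fun h => Or.inl ⟨h, rfl⟩⟩
  rintro (h | ⟨s, t, -, -, h⟩)
  · exact h.1
  · exact absurd h.symm (WithOne.coe_ne_one)

theorem RelationalMorphism.mem_relOne_coe_iff (ρ : RelationalMorphism S T) {s : S}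
    {y : WithOne T} : y ∈ ρ.relOne s ↔ ∃ t ∈ ρ.rel s, y = t := by
  constructor
  · rintro (h | ⟨s', t, h, hs, rfl⟩)
    · exact absurd h.1 WithOne.coe_ne_one
    · exact ⟨t, WithOne.coe_inj.1 hs ▸ h, rfl⟩
  · rintro ⟨t, h, rfl⟩
    exact Or.inr ⟨s, t, h, rfl, rfl⟩

theorem finite_derivedCategory_hom (ρ : RelationalMorphism S T) [Finite S] [Finite T]
    (a b : DerivedCategory ρ) : Finite (a ⟶ b) := by
  have := finite_withOne S
  have := finite_withOne T
  have : Finite (PreArrow ρ a b) :=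
    Finite.of_injective (fun p => (p.fst, p.snd)) fun p q h => by
      cases p
      cases q
      obtain ⟨rfl, rfl⟩ := Prod.ext_iff.1 h
      rfl
  exact inferInstanceAs (Finite (Quotient (preArrowSetoid ρ a b)))

/-- The arrow represented by `p`, as an element of the derived semigroup. -/
def PreArrow.toDerived {ρ : RelationalMorphism S T} {a b : WithOne T} (p : PreArrow ρ a b) :
    DerivedSemigroup ρ :=
  Consolidation.arrow (C := DerivedCategory ρ) (X := a) (Y := b) (Quotient.mk _ p)

theorem PreArrow.toDerived_mul {ρ : RelationalMorphism S T} {a b c : WithOne T}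
    (p : PreArrow ρ a b) (q : PreArrow ρ b c) :
    p.toDerived * q.toDerived = (p.comp q).toDerived :=
  Consolidation.arrow_mul_arrow _ _

theorem PreArrow.toDerived_eq_iff {ρ : RelationalMorphism S T} {a b a' b' : WithOne T}
    {p : PreArrow ρ a b} {q : PreArrow ρ a' b'} :
    p.toDerived = q.toDerived ↔
      a = a' ∧ b = b' ∧ ∀ z : WithOne S, a ∈ ρ.relOne z → z * p.fst = z * q.fst := by
  constructor
  · intro h
    injection h with h₁ h₂ h₃
    cases h₁
    cases h₂
    exact ⟨rfl, rfl, Quotient.exact (s := preArrowSetoid ρ a b) (eq_of_heq h₃)⟩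
  · rintro ⟨rfl, rfl, h⟩
    exact congrArg (Consolidation.arrow (C := DerivedCategory ρ) (X := a) (Y := b))
      (Quotient.sound (s := preArrowSetoid ρ a b) h)

theorem DerivedSemigroup.eq_zero_or_exists {ρ : RelationalMorphism S T}
    (d : DerivedSemigroup ρ) :
    d = Consolidation.zero ∨ ∃ (a b : WithOne T) (p : PreArrow ρ a b), d = p.toDerived := by
  rcases d with _ | @⟨a, b, f⟩
  · exact Or.inl rfl
  · induction f using Quotient.inductionOn with
    | h p => exact Or.inr ⟨a, b, p, rfl⟩

/-- The arrow at `a` given by a pair of related elements. -/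
def RelationalMorphism.preArrow (ρ : RelationalMorphism S T) (a : WithOne T) {s : S} {t : T}
    (h : t ∈ ρ.rel s) : PreArrow ρ a (a * t) :=
  ⟨s, t, ρ.mem_relOne_coe_iff.2 ⟨t, h, rfl⟩, rfl⟩

end Derived

/-- The derived semigroup theorem: `s` is related to the pairs `(f, t)` with `t` related to `s` and
`f a` the arrow at `a` given by `s` and `t`. The arrow at `1` determines `s`. -/
theorem divides_wreath_derivedSemigroup {S T : Type u} [Semigroup S] [Semigroup T]
    (ρ : RelationalMorphism S T) : Divides S (Wreath (DerivedSemigroup ρ) T) := by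
  refine ⟨{ rel := fun s =>
              {x | ∃ h : x.right ∈ ρ.rel s, ∀ a, x.left a = (ρ.preArrow a h).toDerived}
            nonempty := fun s => ?_
            mul_mem := ?_ }, ?_⟩
  · obtain ⟨t, ht⟩ := ρ.nonempty s
    exact ⟨⟨fun a => (ρ.preArrow a ht).toDerived, t⟩, ht, fun _ => rfl⟩
  · rintro s s' x x' ⟨h, hx⟩ ⟨h', hx'⟩
    refine ⟨ρ.mul_mem h h', fun a => ?_⟩
    change x.left a * x'.left (a * x.right) = _
    rw [hx, hx', PreArrow.toDerived_mul, PreArrow.toDerived_eq_iff]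
    exact ⟨rfl, mul_assoc _ _ _, fun z _ => rfl⟩
  · rintro s s' x ⟨h, hx⟩ ⟨h', hx'⟩
    have key := (hx 1).symm.trans (hx' 1)
    rw [PreArrow.toDerived_eq_iff] at key
    have : (1 * s : WithOne S) = 1 * s' := key.2.2 1 ρ.one_mem_relOne
    rw [one_mul, one_mul] at this
    exact WithOne.coe_inj.1 this

/-! ### Aperiodic left factors are absorbed -/

/-- The projection of an iterated semidirect product `S ⋊ (X ⋊ Y)` to `Y`. -/
def iteratedProj {S X Y : Type u} [Semigroup S] [Semigroup X] [Semigroup Y]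
    {γ : LeftAction Y X} (β : LeftAction (Semidirect γ) S) : Semidirect β →ₙ* Y where
  toFun u := u.right.right
  map_mul' _ _ := rfl

/-- A loop at `a` fixes the `Y`-component of every element over `a`, so its powers act on the
remaining components, which are aperiodic. -/
theorem isAperiodic_derivedSemigroup_iteratedProj {S X Y : Type u} [Semigroup S] [Semigroup X]
    [Semigroup Y] [Finite Y] {γ : LeftAction Y X} (β : LeftAction (Semidirect γ) S)
    (hS : IsAperiodic S) (hX : IsAperiodic X) :
    IsAperiodic (DerivedSemigroup (RelationalMorphism.ofHom (iteratedProj β))) := by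
  have := hS.1
  have := hX.1
  have := finite_semidirect γ
  have := finite_semidirect β
  have := finite_withOne (Semidirect β)
  set ρ := RelationalMorphism.ofHom (iteratedProj β) with hρ
  have : Finite (DerivedCategory ρ) := finite_withOne Y
  have := fun a b : DerivedCategory ρ => finite_derivedCategory_hom ρ a b
  refine isAperiodic_consolidation fun a f => ?_
  induction f using Quotient.inductionOn with
  | h p =>
    let cls (q : PreArrow ρ a a) : a ⟶ a := Quotient.mk _ q
    have hiter (N : ℕ) : ∃ q : PreArrow ρ a a, q.fst = (· * p.fst)^[N] p.fst ∧
        (fun g : a ⟶ a => g ≫ cls p)^[N] (cls p) = cls q := by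
      induction N with
      | zero => exact ⟨p, rfl, rfl⟩
      | succ N ih =>
        obtain ⟨q, hq, h⟩ := ih
        refine ⟨q.comp p, ?_, ?_⟩
        · rw [Function.iterate_succ_apply', ← hq]
          rfl
        · rw [Function.iterate_succ_apply', h]
          rfl
    have hstab (z : WithOne (Semidirect β)) (hz : (a : WithOne Y) ∈ ρ.relOne z) :
        Stabilizes z p.fst := by
      obtain ⟨x, y, hxy, hy⟩ := p
      change Stabilizes z x
      induction x using WithOne.recOneCoe with
      | one => exact .of_mul_eq (mul_one z)
      | coe u =>
        obtain ⟨_, rfl, rfl⟩ := ρ.mem_relOne_coe_iff.1 hxy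
        induction z using WithOne.recOneCoe with
        | one =>
          rcases hz with h | ⟨s, t, -, h, -⟩
          · rw [h.2, one_mul] at hy
            exact absurd hy WithOne.coe_ne_one
          · exact absurd h.symm WithOne.coe_ne_one
        | coe z =>
          obtain ⟨_, rfl, rfl⟩ := ρ.mem_relOne_coe_iff.1 hz
          refine Stabilizes.map (f := WithOne.coeMulHom) (z := z) (x := u) ?_
          refine .semidirect β (fun s => hS.stabilizes s s)
            (.semidirect γ (fun s => hX.stabilizes s s) (.of_mul_eq ?_))
          exact WithOne.coe_inj.1 hy
    have hev : ∀ᶠ N in atTop, ∀ z : WithOne (Semidirect β), (a : WithOne Y) ∈ ρ.relOne z →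
        z * ((· * p.fst)^[N] p.fst * p.fst) = z * (· * p.fst)^[N] p.fst := by
      refine eventually_all.2 fun z => eventually_imp_distrib_left.2 fun hz => ?_
      have hzp : (a : WithOne Y) ∈ ρ.relOne (z * p.fst) := by
        have := ρ.mul_mem_relOne hz p.mem
        rwa [p.target] at this
      filter_upwards [(hstab _ hzp).eventually] with N hN
      rw [← mul_assoc, mul_iterate_mul, hN]
    obtain ⟨N, hN⟩ := hev.exists
    obtain ⟨q, hq, h⟩ := hiter N
    refine ⟨N, ?_⟩
    change (fun g : a ⟶ a => g ≫ cls p)^[N] (cls p) ≫ cls p =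
      (fun g : a ⟶ a => g ≫ cls p)^[N] (cls p)
    rw [h]
    refine Quotient.sound fun z hz => ?_
    change z * (q.fst * p.fst) = z * q.fst
    rw [hq, hN z hz]

/-- `A ∗ Cₙ ⊆ Cₙ`: a semidirect product `A ⋊ (B ⋊ Y)` with `A` and `B` aperiodic divides the wreath
product of an aperiodic derived semigroup with `Y`. -/
theorem complexityClass_of_mem_aperiodicStar (n : ℕ) {S : Type u} [Semigroup S]
    (hS : aperiodicStar (complexityClass n) S) : complexityClass n S := by
  have hA := isPseudovariety_isAperiodic.{u}
  obtain ⟨A, X, _, _, β, hA₁, hX, h⟩ :=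
    exists_divides_of_mem_aperiodicStar (isPseudovariety_complexityClass n) hS
  cases n with
  | zero => exact hA.of_divides h (hA₁.semidirect hX β)
  | succ n =>
    have hW := (isPseudovariety_complexityClass.{u} n).groupStar
    obtain ⟨B, Y, _, _, γ, hB, hY, h'⟩ := exists_divides_of_mem_aperiodicStar hW hX
    have := hA₁.1
    have := hB.1
    have := hW.finite _ hY
    have := finite_semidirect γ
    have := finite_withOne (Semidirect γ)
    have := finite_withOne Y
    let β' := translation (Semidirect γ) A
    have hD := isAperiodic_derivedSemigroup_iteratedProj β' (hA.pi hA₁ _) hB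
    exact hW.aperiodicStar.of_divides
      ((h.trans (divides_wreath_of_divides β h')).trans (divides_wreath_derivedSemigroup _))
      (semidirect_mem_star _ (hA.pi hD _) hY)

/-! ### Derived semigroups of complexity one -/

/-- `C₁ ∗ Cₙ ⊆ Cₙ₊₁`, for wreath products: the three factors of a member of `C₁` are
peeled off one by one, and the last one is absorbed. -/
theorem complexityClass_wreath {D T : Type u} [Semigroup D] [Semigroup T] {n : ℕ}
    (hD : complexityClass 1 D) (hT : complexityClass n T) :
    complexityClass (n + 1) (Wreath D T) := by
  have hA := isPseudovariety_isAperiodic.{u}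
  have hn := isPseudovariety_complexityClass.{u} n
  have := hn.finite _ hT
  have := finite_withOne T
  obtain ⟨A, X, _, _, β, hA₁, hX, h⟩ := exists_divides_of_mem_aperiodicStar hA.groupStar hD
  obtain ⟨G, B, _, _, γ, _, hB, h'⟩ := exists_divides_of_mem_groupStar hA hX
  have hBT : complexityClass n (Wreath B T) :=
    complexityClass_of_mem_aperiodicStar n (semidirect_mem_star _ (hA.pi hB _) hT)
  have hXT : groupStar (complexityClass n) (Wreath X T) :=
    hn.groupStar.of_divides (h'.wreath.trans (divides_wreath_semidirect γ T))
      (semidirect_mem_star _ ((isFiniteGroup_of_group G).pi _) hBT)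
  exact hn.groupStar.aperiodicStar.of_divides (h.wreath.trans (divides_wreath_semidirect β T))
    (semidirect_mem_star _ (hA.pi hA₁ _) hXT)

/-- The action of a group on functions on it by translation of the argument. -/
def groupTranslation (G : Type u) (M : Type v) [Group G] [Semigroup M] :
    LeftAction G (G → M) where
  act g f h := f (h * g)
  mul_act g g' f := funext fun h => by rw [← mul_assoc]
  act_mul _ _ _ := rfl

section Label

variable {A G T : Type u} [Semigroup A] [Group G] [Semigroup T] {γ : LeftAction T G}
  (β : LeftAction (Semidirect γ) A)

/-- The labels in `(A ∪ {1}) ≀ G` of an arrow of the derived category of `A ⋊ (G ⋊ T) → T` that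
starts at `a` and is given by `v`. For `a = t` in `T` and `v = (p, (g, t'))` the label records the
translates `(h, t) p`, as a function of `h`, together with `t g`. The only element over the
object `1` is `1`, so for `a = 1` only the value at `1` of the function is prescribed. -/
def IsLabel (a : WithOne T) (v : WithOne (Semidirect β))
    (m : Semidirect (groupTranslation G (WithOne A))) : Prop :=
  (v = 1 ∧ m = ⟨1, 1⟩) ∨ ∃ u : Semidirect β, v = u ∧
    ((a = 1 ∧ m.left 1 = u.left ∧ m.right = u.right.left) ∨
      ∃ t : T, a = t ∧ (∀ h, m.left h = β.act ⟨h, t⟩ u.left) ∧ m.right = γ.act t u.right.left)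

theorem exists_isLabel (a : WithOne T) (v : WithOne (Semidirect β)) :
    ∃ m, IsLabel β a v m := by
  induction v using WithOne.recOneCoe with
  | one => exact ⟨_, Or.inl ⟨rfl, rfl⟩⟩
  | coe u =>
    induction a using WithOne.recOneCoe with
    | one => exact ⟨⟨fun _ => u.left, u.right.left⟩, Or.inr ⟨u, rfl, Or.inl ⟨rfl, rfl, rfl⟩⟩⟩
    | coe t =>
      exact ⟨⟨fun h => β.act ⟨h, t⟩ u.left, γ.act t u.right.left⟩,
        Or.inr ⟨u, rfl, Or.inr ⟨t, rfl, fun _ => rfl, rfl⟩⟩⟩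

variable {β}

theorem IsLabel.mul {a : WithOne T} {v v' : WithOne (Semidirect β)}
    {m m' : Semidirect (groupTranslation G (WithOne A))} (h : IsLabel β a v m)
    (h' : IsLabel β (a * WithOne.mapMulHom (iteratedProj β) v) v' m') :
    IsLabel β a (v * v') (m * m') := by
  rcases h with ⟨rfl, rfl⟩ | ⟨u, rfl, h⟩
  · have hm : (⟨1, 1⟩ * m' : Semidirect (groupTranslation G (WithOne A))) = m' := by
      refine Semidirect.ext (funext fun k => ?_) (one_mul m'.right)
      change 1 * m'.left (k * 1) = _
      rw [one_mul, mul_one]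
    rw [map_one, mul_one] at h'
    rwa [one_mul, hm]
  rcases h' with ⟨rfl, rfl⟩ | ⟨u', rfl, h'⟩
  · have hm : (m * ⟨1, 1⟩ : Semidirect (groupTranslation G (WithOne A))) = m :=
      Semidirect.ext (funext fun k => mul_one (m.left k)) (mul_one m.right)
    rw [mul_one, hm]
    exact Or.inr ⟨u, rfl, h⟩
  refine Or.inr ⟨u * u', (WithOne.coe_mul u u').symm, ?_⟩
  rw [WithOne.mapMulHom_coe] at h'
  rcases h with ⟨rfl, hl, hr⟩ | ⟨t, rfl, hl, hr⟩
  · rw [one_mul] at h'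
    rcases h' with ⟨h, -⟩ | ⟨t', ht', hl', hr'⟩
    · exact absurd h WithOne.coe_ne_one
    obtain rfl := WithOne.coe_inj.1 ht'
    refine Or.inl ⟨rfl, ?_, ?_⟩
    · change m.left 1 * m'.left (1 * m.right) = _
      rw [one_mul, hl, hl', hr, ← WithOne.coe_mul]
      rfl
    · change m.right * m'.right = _
      rw [hr, hr']
      rfl
  · rw [← WithOne.coe_mul] at h'
    rcases h' with ⟨h, -⟩ | ⟨t', ht', hl', hr'⟩
    · exact absurd h WithOne.coe_ne_one
    obtain rfl := WithOne.coe_inj.1 ht'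
    refine Or.inr ⟨t, rfl, fun k => ?_, ?_⟩
    · change m.left k * m'.left (k * m.right) = β.act ⟨k, t⟩ (u.left * β.act u.right u'.left)
      rw [hl, hl', hr, β.act_mul, ← β.mul_act, ← WithOne.coe_mul]
      rfl
    · change m.right * m'.right = γ.act t (u.right.left * γ.act u.right.right u'.right.left)
      rw [hr, hr', γ.act_mul, ← γ.mul_act]
      rfl

/-- Among arrows with the same end points, a label at `a` determines the right translation of the
elements over `a`. -/
theorem IsLabel.mul_eq_mul {a : WithOne T} {v v' : WithOne (Semidirect β)}
    {m : Semidirect (groupTranslation G (WithOne A))} (h : IsLabel β a v m)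
    (h' : IsLabel β a v' m)
    (hv : a * WithOne.mapMulHom (iteratedProj β) v = a * WithOne.mapMulHom (iteratedProj β) v')
    {w : WithOne (Semidirect β)} (hw : WithOne.mapMulHom (iteratedProj β) w = a) :
    w * v = w * v' := by
  -- The function in the label of an identity arrow takes the value `1`, which the functions in
  -- the labels of the other arrows avoid.
  have hne (u : Semidirect β) (f : G → WithOne A) (g : G) (hf : f 1 = 1)
      (h : IsLabel β a u ⟨f, g⟩) : False := by
    rcases h with ⟨h, -⟩ | ⟨u, -, ⟨-, h, -⟩ | ⟨t, -, h, -⟩⟩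
    · exact WithOne.coe_ne_one h
    · exact WithOne.coe_ne_one (h.symm.trans hf)
    · exact WithOne.coe_ne_one ((h 1).symm.trans hf)
  induction v using WithOne.recOneCoe with
  | one =>
    induction v' using WithOne.recOneCoe with
    | one => rfl
    | coe u' =>
      rcases h with ⟨-, rfl⟩ | ⟨u, h, -⟩
      · exact (hne _ _ _ rfl h').elim
      · exact absurd h.symm WithOne.coe_ne_one
  | coe u =>
    induction v' using WithOne.recOneCoe with
    | one =>
      rcases h' with ⟨-, rfl⟩ | ⟨u, h', -⟩
      · exact (hne _ _ _ rfl h).elim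
      · exact absurd h'.symm WithOne.coe_ne_one
    | coe u' =>
      rcases h with ⟨h, -⟩ | ⟨_, h₀, h⟩
      · exact absurd h WithOne.coe_ne_one
      obtain rfl := WithOne.coe_inj.1 h₀
      rcases h' with ⟨h, -⟩ | ⟨_, h₀', h'⟩
      · exact absurd h WithOne.coe_ne_one
      obtain rfl := WithOne.coe_inj.1 h₀'
      rw [WithOne.mapMulHom_coe, WithOne.mapMulHom_coe] at hv
      induction w using WithOne.recOneCoe with
      | one =>
        rw [map_one] at hw
        subst hw
        rw [one_mul, one_mul] at hv ⊢
        rcases h with ⟨-, hl, hr⟩ | ⟨t, h, -⟩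
        · rcases h' with ⟨-, hl', hr'⟩ | ⟨t, h, -⟩
          · exact congrArg _ (Semidirect.ext (WithOne.coe_inj.1 (hl.symm.trans hl'))
              (Semidirect.ext (hr.symm.trans hr') (WithOne.coe_inj.1 hv)))
          · exact absurd h.symm WithOne.coe_ne_one
        · exact absurd h.symm WithOne.coe_ne_one
      | coe w =>
        rw [WithOne.mapMulHom_coe] at hw
        subst hw
        rw [← WithOne.coe_mul, ← WithOne.coe_mul] at hv ⊢
        rcases h with ⟨h, -⟩ | ⟨t, h, hl, hr⟩
        · exact absurd h WithOne.coe_ne_one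
        obtain rfl := WithOne.coe_inj.1 h
        rcases h' with ⟨h, -⟩ | ⟨t, h, hl', hr'⟩
        · exact absurd h WithOne.coe_ne_one
        obtain rfl := WithOne.coe_inj.1 h
        refine congrArg _ (Semidirect.ext ?_ (Semidirect.ext ?_ (WithOne.coe_inj.1 hv)))
        · exact congrArg (w.left * ·) (WithOne.coe_inj.1
            ((hl w.right.left).symm.trans (hl' w.right.left)))
        · exact congrArg (w.right.left * ·) (hr.symm.trans hr')

end Label

/-- The relational morphism from a divisor `S` of `A ⋊ (G ⋊ T)` to `T`. -/
abbrev RelationalMorphism.toBase {S A G T : Type u} [Semigroup S] [Semigroup A] [Group G]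
    [Semigroup T] {γ : LeftAction T G} {β : LeftAction (Semidirect γ) A}
    (δ : RelationalMorphism S (Semidirect β)) : RelationalMorphism S T :=
  δ.comp (.ofHom (iteratedProj β))

theorem RelationalMorphism.mem_relOne_toBase_iff {S A G T : Type u} [Semigroup S] [Semigroup A]
    [Group G] [Semigroup T] {γ : LeftAction T G} {β : LeftAction (Semidirect γ) A}
    (δ : RelationalMorphism S (Semidirect β)) {x : WithOne S} {y : WithOne T} :
    y ∈ δ.toBase.relOne x ↔
      ∃ v ∈ δ.relOne x, WithOne.mapMulHom (iteratedProj β) v = y := by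
  constructor
  · rintro (⟨rfl, rfl⟩ | ⟨s, _, ⟨u, hu, rfl⟩, rfl, rfl⟩)
    · exact ⟨1, δ.one_mem_relOne, map_one _⟩
    · exact ⟨u, δ.mem_relOne_coe_iff.2 ⟨u, hu, rfl⟩, rfl⟩
  · rintro ⟨v, ⟨rfl, rfl⟩ | ⟨s, u, hu, rfl, rfl⟩, rfl⟩
    · exact Or.inl ⟨rfl, map_one _⟩
    · exact Or.inr ⟨s, _, ⟨u, hu, rfl⟩, rfl, rfl⟩

/-- An arrow is related to the pairs that consist of a label and of its two end points. -/
theorem divides_derivedSemigroup_toBase {S A G T : Type u} [Semigroup S] [Semigroup A] [Group G]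
    [Semigroup T] {γ : LeftAction T G} {β : LeftAction (Semidirect γ) A}
    (δ : RelationalMorphism S (Semidirect β))
    (hδ : ∀ {s s' t}, t ∈ δ.rel s → t ∈ δ.rel s' → s = s') :
    Divides (DerivedSemigroup δ.toBase)
      (Semidirect (groupTranslation G (WithOne A)) × Consolidation (Codiscrete (WithOne T))) := by
  let edge (a b : WithOne T) : Consolidation (Codiscrete (WithOne T)) :=
    .arrow (X := ⟨a⟩) (Y := ⟨b⟩) ()
  have hedge {a b a' b' : WithOne T} (h : edge a b = edge a' b') : a = a' ∧ b = b' := by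
    injection h with h₁ h₂
    exact ⟨congrArg Codiscrete.as h₁, congrArg Codiscrete.as h₂⟩
  have hzero {a b : WithOne T} (h : .zero = edge a b) : False := by cases h
  refine ⟨{ rel := fun d => {x | (d = .zero ∧ x.2 = .zero) ∨
              ∃ (a b : WithOne T) (p : PreArrow δ.toBase a b), ∃ v ∈ δ.relOne p.fst,
                WithOne.mapMulHom (iteratedProj β) v = p.snd ∧ IsLabel β a v x.1 ∧
                d = p.toDerived ∧ x.2 = edge a b}
            nonempty := fun d => ?_
            mul_mem := ?_ }, ?_⟩
  · rcases d.eq_zero_or_exists with rfl | ⟨a, b, p, rfl⟩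
    · exact ⟨(⟨1, 1⟩, .zero), Or.inl ⟨rfl, rfl⟩⟩
    · obtain ⟨v, hv, hvp⟩ := δ.mem_relOne_toBase_iff.1 p.mem
      obtain ⟨m, hm⟩ := exists_isLabel β a v
      exact ⟨(m, edge a b), Or.inr ⟨a, b, p, v, hv, hvp, hm, rfl, rfl⟩⟩
  · rintro d d' ⟨m, e⟩ ⟨m', e'⟩ h h'
    rcases h with ⟨rfl, h⟩ | ⟨a, b, p, v, hv, hvp, hm, rfl, h⟩
    · obtain rfl : e = _ := h
      exact Or.inl ⟨Consolidation.zero_mul _, Consolidation.zero_mul _⟩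
    obtain rfl : e = _ := h
    rcases h' with ⟨rfl, h⟩ | ⟨a', c, q, v', hv', hvq, hm', rfl, h⟩
    · obtain rfl : e' = _ := h
      exact Or.inl ⟨Consolidation.mul_zero _, Consolidation.mul_zero _⟩
    obtain rfl : e' = _ := h
    by_cases hb : b = a'
    · subst hb
      refine Or.inr ⟨a, c, p.comp q, v * v', δ.mul_mem_relOne hv hv', ?_, ?_,
        p.toDerived_mul q, Consolidation.arrow_mul_arrow _ _⟩
      · rw [map_mul, hvp, hvq]
        rfl
      · refine hm.mul ?_
        rwa [hvp, p.target]
    · refine Or.inl ⟨Consolidation.arrow_mul_arrow_of_ne (C := DerivedCategory δ.toBase) hb _ _,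
        Consolidation.arrow_mul_arrow_of_ne (fun h => hb (congrArg Codiscrete.as h)) _ _⟩
  · rintro d d' ⟨m, e⟩ (⟨rfl, h⟩ | ⟨a, b, p, v, hv, hvp, hm, rfl, h⟩)
      (⟨rfl, h'⟩ | ⟨a', b', q, v', hv', hvq, hm', rfl, h'⟩)
    · rfl
    · exact (hzero (h.symm.trans h')).elim
    · exact (hzero (h'.symm.trans h)).elim
    · obtain ⟨rfl, rfl⟩ := hedge (h.symm.trans h')
      refine PreArrow.toDerived_eq_iff.2 ⟨rfl, rfl, fun z hz => ?_⟩
      obtain ⟨w, hw, hwa⟩ := δ.mem_relOne_toBase_iff.1 hz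
      have key := hm.mul_eq_mul hm' (by rw [hvp, hvq, p.target, q.target]) hwa
      have h₁ := δ.mul_mem_relOne hw hv
      have h₂ := δ.mul_mem_relOne hw hv'
      rw [← key] at h₂
      rcases h₁ with ⟨h₁, h₁'⟩ | ⟨s, t, hst, h₁, h₁'⟩
      · rw [h₁'] at h₂
        rw [h₁, δ.one_mem_relOne_iff.1 h₂]
      · rcases h₂ with ⟨-, h₂'⟩ | ⟨s', t', hst', h₂, h₂'⟩
        · exact absurd (h₁'.symm.trans h₂') WithOne.coe_ne_one
        · obtain rfl := WithOne.coe_inj.1 (h₁'.symm.trans h₂')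
          rw [h₁, h₂, hδ hst hst']

theorem complexityClass_one_derivedSemigroup_toBase {S A G T : Type u} [Semigroup S]
    [Semigroup A] [Group G] [Finite G] [Semigroup T] [Finite T] {γ : LeftAction T G}
    {β : LeftAction (Semidirect γ) A} (hA : IsAperiodic A)
    (δ : RelationalMorphism S (Semidirect β))
    (hδ : ∀ {s s' t}, t ∈ δ.rel s → t ∈ δ.rel s' → s = s') :
    complexityClass 1 (DerivedSemigroup δ.toBase) := by
  have h₁ := isPseudovariety_complexityClass.{u} 1
  have hV := isPseudovariety_isAperiodic.{u}
  have := finite_withOne T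
  have : Finite (Codiscrete (WithOne T)) := Finite.of_equiv _ codiscreteEquiv.symm
  have (X Y : Codiscrete (WithOne T)) : Finite (X ⟶ Y) := inferInstanceAs (Finite Unit)
  refine h₁.of_divides (divides_derivedSemigroup_toBase δ hδ) (h₁.prod _ _ ?_ ?_)
  · exact semidirect_mem_star _ (hV.pi hA.withOne G)
      (mem_star_of_mem_left hV.groupStar hV.unit (isFiniteGroup_of_group G))
  · exact complexityClass_mono zero_le_one
      (isAperiodic_consolidation fun X f => ⟨0, rfl⟩)

end KrohnRhodes

/-! ### The characterization of complexity -/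

open KrohnRhodes in
theorem theorem3p4 (S : Type u) [Semigroup S] [Finite S] (n : ℕ) (hn : 1 ≤ n) :
    KrohnRhodes.complexity S ≤ (n : ℕ∞) ↔
      ∃ (T : Type u) (_ : Semigroup T) (_ : Finite T)
        (ρ : KrohnRhodes.RelationalMorphism S T),
        KrohnRhodes.complexity T ≤ ((n - 1 : ℕ) : ℕ∞) ∧
        KrohnRhodes.complexity (KrohnRhodes.DerivedSemigroup ρ) ≤ 1 := by
  obtain ⟨m, rfl⟩ : ∃ m, n = m + 1 := ⟨n - 1, by omega⟩
  have hm := isPseudovariety_complexityClass.{u} m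
  rw [Nat.add_sub_cancel, complexity_le_iff]
  constructor
  · intro hS
    obtain ⟨A, X, _, _, β, hA, hX, h⟩ := exists_divides_of_mem_aperiodicStar hm.groupStar hS
    obtain ⟨G, T, _, _, γ, _, hT, h'⟩ := exists_divides_of_mem_groupStar hm hX
    have hT' := hm.finite _ hT
    have := finite_semidirect γ
    have := finite_withOne (Semidirect γ)
    obtain ⟨δ, hδ⟩ := h.trans (divides_wreath_of_divides β h')
    exact ⟨T, _, hT', δ.toBase, complexity_le_iff.2 hT, (complexity_le_iff (n := 1)).2
      (complexityClass_one_derivedSemigroup_toBase (isPseudovariety_isAperiodic.pi hA _) δ hδ)⟩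
  · rintro ⟨T, _, _, ρ, hT, hD⟩
    exact hm.groupStar.aperiodicStar.of_divides (divides_wreath_derivedSemigroup ρ)
      (complexityClass_wreath ((complexity_le_iff (n := 1)).1 hD) (complexity_le_iff.1 hT))
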